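/- Let $d\in\mathbb N$ and let $V:\mathbb R^d\to\mathbb R$ be a potential in $L^p(\mathbb R^d)+L^\infty(\mathbb R^d)$ for some $p>\max\{1,d/2\}$. Let $H=-\tfrac12\Delta+V$ be the associated self-adjoint operator on $L^2(\mathbb R^d;\mathbb C)$ (defined through its quadratic form on $H^1(\mathbb R^d)$), write $\langle f,g\rangle=\int_{\mathbb R^d}\overline{f}\,g\,dx$, and let $K>0$, $\Omega\ge 0$, $\Lambda=2\Omega/K$. Let $\psi_{1,0},\psi_{2,0}\in L^2(\mathbb R^d)$ with $\|\psi_{1,0}\|_{L^2}=\|\psi_{2,0}\|_{L^2}=1$, and let $(\psi_1,\psi_2)\in C([0,\infty);L^2(\mathbb R^d))$ be the (mild) solution with initial data $(\psi_{1,0},\psi_{2,0})$ of the two-oscillator Schrödinger–Lohe system $$i\partial_t\psi_1=-\tfrac12\Delta\psi_1+V\psi_1+\Omega\psi_1+i\tfrac K4\big(\psi_2-\langle\psi_2,\psi_1\rangle\psi_1\big),$$ $$i\partial_t\psi_2=-\tfrac12\Delta\psi_2+V\psi_2-\Omega\psi_2+i\tfrac K4\big(\psi_1-\langle\psi_1,\psi_2\rangle\psi_2\big).$$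 Put $\zeta=\tfrac12(\psi_1+\psi_2)$. 1. If $0\le\Lambda<1$ and $\langle\psi_{1,0},\psi_{2,0}\rangle\ne-\sqrt{1-\Lambda^2}+i\Lambda$, then there is complete synchronization: for $\Lambda=0$ complete phase synchronization, i.e. $\|\psi_1(t)-\psi_2(t)\|_{L^2}\to0$ and $\|\zeta(t)\|_{L^2}\to1$ as $t\to\infty$; for $0<\Lambda<1$ complete frequency synchronization, i.e. $\|\psi_1(t)-\psi_2(t)\|_{L^2}$ converges and $\|\zeta(t)\|_{L^2}$ converges to a limit in $(0,1)$. Moreover, with $\phi=\arcsin\Lambda$, $$\|e^{i\phi}\psi_1(t)-\psi_2(t)\|_{L^2}^2=O\big(e^{-\sqrt{K^2-4\Omega^2}\,t}\big)\quad\text{as }t\to\infty,\qquad \lim_{t\to\infty}\|\psi_1(t)-\psi_2(t)\|_{L^2}=|1-e^{i\phi}|.$$ 2. If $\Lambda=1$ and $\langle\psi_{1,0},\psi_{2,0}\rangle\ne i$, then $$\|i\psi_1(t)-\psi_2(t)\|_{L^2}=O(t^{-1})\quad\text{as }t\to\infty,\qquad \lim_{t\to\infty}\|\psi_1(t)-\psi_2(t)\|_{L^2}=\sqrt2.$$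 3. If $\Lambda>1$, the correlations are periodic in time: there is $T>0$ such that $\langle\psi_j,\psi_k\rangle(t+T)=\langle\psi_j,\psi_k\rangle(t)$ for all $j,k\in\{1,2\}$ and all $t\ge0$. -/

import Mathlib

open MeasureTheory Filter Topology Asymptotics
open scoped ContDiff ENNReal

noncomputable section

namespace SchrodingerLohe

/-- The Hilbert space `L²(ℝᵈ; ℂ)`; its inner product `inner ℂ f g` is `∫ conj f * g`. -/
abbrev L2 (d : ℕ) : Type :=
  Lp ℂ 2 (volume : Measure (EuclideanSpace ℝ (Fin d)))

/-- `V ∈ Lᵖ(ℝᵈ) + L^∞(ℝᵈ)` for some `p > max {1, d/2}` (`V` is real valued). -/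
def AdmissiblePotential {d : ℕ} (V : EuclideanSpace ℝ (Fin d) → ℝ) : Prop :=
  ∃ (p : ℝ≥0∞) (V₁ V₂ : EuclideanSpace ℝ (Fin d) → ℝ),
    max 1 ((d : ℝ≥0∞) / 2) < p ∧ MemLp V₁ p volume ∧ MemLp V₂ ∞ volume ∧
      V =ᵐ[volume] V₁ + V₂

/-- `g = ∂ᵢ u` in the sense of distributions, for `u, g ∈ L²(ℝᵈ)`. -/
def IsWeakPartial {d : ℕ} (i : Fin d) (u g : L2 d) : Prop :=
  ∀ φ : EuclideanSpace ℝ (Fin d) → ℂ, ContDiff ℝ ∞ φ → HasCompactSupport φ →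
    ∫ x, u x * fderiv ℝ φ x (EuclideanSpace.single i 1) = - ∫ x, g x * φ x

/-- `u ∈ H¹(ℝᵈ)` with weak gradient `G ∈ L²(ℝᵈ)ᵈ`. -/
def IsWeakGradient {d : ℕ} (u : L2 d) (G : Fin d → L2 d) : Prop :=
  ∀ i, IsWeakPartial i u (G i)

/-- The graph of the Hamiltonian `H = -½ Δ + V`: the relation `SchrodingerOp V u f` says that
`u ∈ D(H)` and `H u = f`. Here `H` is the operator associated with the quadratic form of `-½ Δ + V`
on `H¹(ℝᵈ)`: one has `u ∈ H¹`, `f ∈ L²` and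
`½ ∫ conj ∇v · ∇u + ∫ V conj v u = ⟨v, f⟩` for every `v ∈ H¹(ℝᵈ)`. -/
def SchrodingerOp {d : ℕ} (V : EuclideanSpace ℝ (Fin d) → ℝ) (u f : L2 d) : Prop :=
  ∃ Gu : Fin d → L2 d, IsWeakGradient u Gu ∧
    ∀ (v : L2 d) (Gv : Fin d → L2 d), IsWeakGradient v Gv →
      (1 / 2 : ℂ) * ∑ i, inner ℂ (Gv i) (Gu i)
        + ∫ x, (V x : ℂ) * (starRingEnd ℂ (v x) * u x) = inner ℂ v f

/-- `U t = exp (-i t H)`, `H = -½ Δ + V`: the strongly continuous one-parameter group of bounded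
operators on `L²(ℝᵈ)` whose infinitesimal generator is exactly `-i H` (same domain, same values). -/
structure IsSchrodingerGroup {d : ℕ} (V : EuclideanSpace ℝ (Fin d) → ℝ)
    (U : ℝ → L2 d →L[ℂ] L2 d) : Prop where
  map_zero : U 0 = ContinuousLinearMap.id ℂ (L2 d)
  map_add : ∀ s t : ℝ, U (s + t) = (U s).comp (U t)
  strongly_continuous : ∀ u : L2 d, Continuous fun t : ℝ => U t u
  generator : ∀ u f : L2 d,
    HasDerivAt (fun t : ℝ => U t u) (-(Complex.I • f)) 0 ↔ SchrodingerOp V u f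

/-- The part of the right-hand side of the equation for `i ∂ₜ ψ` that is added to `H ψ`, for an
oscillator in the state `ψ` with natural frequency `ν`, coupled to an oscillator in the state `χ`:
`ν ψ + i (K / 4) (χ - ⟨χ, ψ⟩ ψ)`. -/
def loheTerm {d : ℕ} (K ν : ℝ) (ψ χ : L2 d) : L2 d :=
  (ν : ℂ) • ψ + (Complex.I * ((K / 4 : ℝ) : ℂ)) • (χ - inner ℂ χ ψ • ψ)

/-- `(ψ 0, ψ 1) ∈ C([0, ∞); L²(ℝᵈ))` is the (mild) solution with initial data `(ψ₀ 0, ψ₀ 1)` of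
`i ∂ₜ ψ₁ = -½ Δ ψ₁ + V ψ₁ + Ω ψ₁ + i (K / 4) (ψ₂ - ⟨ψ₂, ψ₁⟩ ψ₁)`,
`i ∂ₜ ψ₂ = -½ Δ ψ₂ + V ψ₂ - Ω ψ₂ + i (K / 4) (ψ₁ - ⟨ψ₁, ψ₂⟩ ψ₂)`,
that is, it satisfies Duhamel's formula. Values at negative times are irrelevant. -/
def IsSolution {d : ℕ} (V : EuclideanSpace ℝ (Fin d) → ℝ) (K Ω : ℝ)
    (ψ₀ : Fin 2 → L2 d) (ψ : Fin 2 → ℝ → L2 d) : Prop :=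
  (∀ j, ContinuousOn (ψ j) (Set.Ici 0)) ∧
  ∃ U : ℝ → L2 d →L[ℂ] L2 d, IsSchrodingerGroup V U ∧
    ∀ t : ℝ, 0 ≤ t →
      ψ 0 t = U t (ψ₀ 0)
        - Complex.I • ∫ s in (0 : ℝ)..t, U (t - s) (loheTerm K Ω (ψ 0 s) (ψ 1 s)) ∧
      ψ 1 t = U t (ψ₀ 1)
        - Complex.I • ∫ s in (0 : ℝ)..t, U (t - s) (loheTerm K (-Ω) (ψ 1 s) (ψ 0 s))

/-- The order parameter `ζ = (1 / N) ∑ ψ_ℓ`. -/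
def orderParameter {d N : ℕ} (ψ : Fin N → ℝ → L2 d) (t : ℝ) : L2 d :=
  ((N : ℂ)⁻¹) • ∑ l, ψ l t

/-- Complete frequency synchronization: all the distances `‖ψ_j - ψ_k‖` converge, and `‖ζ‖`
converges to a limit in `(0, 1)`. -/
def CompleteFrequencySync {d N : ℕ} (ψ : Fin N → ℝ → L2 d) : Prop :=
  (∀ j k, ∃ c : ℝ, Tendsto (fun t => ‖ψ j t - ψ k t‖) atTop (𝓝 c)) ∧
  ∃ c : ℝ, c ∈ Set.Ioo (0 : ℝ) 1 ∧ Tendsto (fun t => ‖orderParameter ψ t‖) atTop (𝓝 c)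

/-- Complete phase synchronization: all the distances `‖ψ_j - ψ_k‖` converge to `0`, and `‖ζ‖`
converges to `1`. -/
def CompletePhaseSync {d N : ℕ} (ψ : Fin N → ℝ → L2 d) : Prop :=
  (∀ j k, Tendsto (fun t => ‖ψ j t - ψ k t‖) atTop (𝓝 0)) ∧
  Tendsto (fun t => ‖orderParameter ψ t‖) atTop (𝓝 1)

end SchrodingerLohe

end

namespace SchrodingerLohe

/-! The whole dynamics is carried by one complex number, the correlation `z = ⟨ψ₁, ψ₂⟩`. While both
norms equal 1, the Hamiltonian drops out and `z' = 2iΩz + (K/2)(1 - z²) = -(K/2)(z - p)(z - q)`,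
with `p + q = 2iΛ` and `pq = -1`. A mild solution need not be differentiable, so the equation is
derived in the interaction picture `U (-t) ψ` (`IsUnitaryGroup.hasDerivWithinAt_interaction`). This
needs `U` to be isometric, which `norm_group_apply` extracts from the realness of the quadratic form
of `H`.

The Riccati equation is solved explicitly. For distinct roots `(z - p)/(z - q)` is a pure
exponential: it decays if `Λ < 1`, and rotates if `Λ > 1`, since then `p - q` is imaginary. For `Λ =
1` the root is double and `(z - i)⁻¹` is affine in `t`. Distances and the order parameter depend on
`z` alone (`norm_smul_sub_sq`, `norm_orderParameter_two`). -/

theorem hasDerivWithinAt_integral_Ici {E : Type*} [NormedAddCommGroup E] [NormedSpace ℝ E]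
    [CompleteSpace E] {g : ℝ → E} (hg : ContinuousOn g (Set.Ici 0)) {t : ℝ} (ht : 0 ≤ t) :
    HasDerivWithinAt (fun t => ∫ s in (0 : ℝ)..t, g s) (g t) (Set.Ici 0) t := by
  -- Freezing `g` at its value at 0 for negative times makes it continuous on the whole line.
  have hc : Continuous fun s => g (max s 0) :=
    hg.comp_continuous (by fun_prop) fun s => Set.mem_Ici.2 (le_max_right _ _)
  have h1 := (hc.integral_hasStrictDerivAt 0 t).hasDerivAt.hasDerivWithinAt (s := Set.Ici 0)
  have e : ∀ t ∈ Set.Ici (0 : ℝ),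
      ∫ s in (0 : ℝ)..t, g s = ∫ s in (0 : ℝ)..t, g (max s 0) := by
    intro t ht
    refine intervalIntegral.integral_congr fun s hs => ?_
    rw [Set.uIcc_of_le ht] at hs
    simp only [max_eq_left hs.1]
  simp only [max_eq_left ht] at h1
  exact h1.congr e (e t ht)

/-- Integrating factor: `y * exp (-P)` has zero derivative. -/
theorem eq_mul_exp_of_hasDerivWithinAt {y a P : ℝ → ℂ}
    (hy : ∀ t, 0 ≤ t → HasDerivWithinAt y (a t * y t) (Set.Ici 0) t)
    (hP : ∀ t, 0 ≤ t → HasDerivWithinAt P (a t) (Set.Ici 0) t) (hP0 : P 0 = 0)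
    {t : ℝ} (ht : 0 ≤ t) : y t = y 0 * Complex.exp (P t) := by
  have hd : ∀ t, 0 ≤ t →
      HasDerivWithinAt (fun t => y t * Complex.exp (-P t)) 0 (Set.Ici 0) t := by
    intro t ht
    refine ((hy t ht).mul (hP t ht).neg.cexp).congr_deriv ?_
    ring
  have h1 := constant_of_has_deriv_right_zero (a := 0) (b := t)
    (fun s hs => (hd s hs.1).continuousWithinAt.mono fun r hr => hr.1)
    (fun s hs => (hd s hs.1).mono fun r hr => hs.1.trans hr) t ⟨ht, le_rfl⟩
  simp only [hP0, neg_zero, Complex.exp_zero, mul_one] at h1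
  rw [← h1, mul_assoc, ← Complex.exp_add, neg_add_cancel, Complex.exp_zero, mul_one]

theorem eq_mul_exp_integral {y a : ℝ → ℂ}
    (hy : ∀ t, 0 ≤ t → HasDerivWithinAt y (a t * y t) (Set.Ici 0) t)
    (ha : ContinuousOn a (Set.Ici 0)) {t : ℝ} (ht : 0 ≤ t) :
    y t = y 0 * Complex.exp (∫ s in (0 : ℝ)..t, a s) :=
  eq_mul_exp_of_hasDerivWithinAt hy (fun _ h => hasDerivWithinAt_integral_Ici ha h) (by simp) ht

/-! ### Explicit solution of the complex Riccati equation -/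

section Riccati

variable {z : ℝ → ℂ} {k p q : ℂ}

/-- Along a given solution, `z - q` solves a linear homogeneous equation with continuous coefficient
`-k (z - p)`, so it is its initial value times an exponential. -/
theorem riccati_ne_of_ne
    (hz : ∀ t, 0 ≤ t → HasDerivWithinAt z (-k * (z t - p) * (z t - q)) (Set.Ici 0) t)
    (h0 : z 0 ≠ q) {t : ℝ} (ht : 0 ≤ t) : z t ≠ q := by
  have hc : ContinuousOn (fun t => -k * (z t - p)) (Set.Ici 0) :=
    continuousOn_const.mul
      (ContinuousOn.sub (fun t ht => (hz t ht).continuousWithinAt) continuousOn_const)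
  have h := eq_mul_exp_integral (y := fun t => z t - q) (fun t ht => (hz t ht).sub_const q) hc ht
  rw [← sub_ne_zero]
  rw [h]
  exact mul_ne_zero (sub_ne_zero.2 h0) (Complex.exp_ne_zero _)

/-- The Möbius quotient `(z - p)/(z - q)` linearizes the equation. Keeping `z t - q` on the right
makes an a priori bound on `z` directly usable. -/
theorem riccati_formula
    (hz : ∀ t, 0 ≤ t → HasDerivWithinAt z (-k * (z t - p) * (z t - q)) (Set.Ici 0) t)
    (h0 : z 0 ≠ q) {t : ℝ} (ht : 0 ≤ t) :
    z t - p = (z 0 - p) / (z 0 - q) * Complex.exp (-k * (p - q) * t) * (z t - q) := by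
  have hne : ∀ t, 0 ≤ t → z t - q ≠ 0 := fun t ht => sub_ne_zero.2 (riccati_ne_of_ne hz h0 ht)
  have h := eq_mul_exp_of_hasDerivWithinAt (y := fun t => (z t - p) / (z t - q))
    (a := fun _ => -k * (p - q)) (P := fun t : ℝ => -k * (p - q) * t) (fun t ht => by
      have hq := hne t ht
      refine (((hz t ht).sub_const p).div ((hz t ht).sub_const q) hq).congr_deriv ?_
      field_simp
      ring) (fun t _ => by
      simpa using ((Complex.ofRealCLM.hasDerivAt (x := t)).const_mul
        (-k * (p - q))).hasDerivWithinAt)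
    (by simp) ht
  rw [← h, div_mul_cancel₀ _ (hne t ht)]

theorem riccati_double_formula
    (hz : ∀ t, 0 ≤ t → HasDerivWithinAt z (-k * (z t - p) * (z t - p)) (Set.Ici 0) t)
    (h0 : z 0 ≠ p) {t : ℝ} (ht : 0 ≤ t) : (z t - p)⁻¹ = (z 0 - p)⁻¹ + k * t := by
  have hne : ∀ t, 0 ≤ t → z t - p ≠ 0 := fun t ht => sub_ne_zero.2 (riccati_ne_of_ne hz h0 ht)
  have hd : ∀ t, 0 ≤ t →
      HasDerivWithinAt (fun t : ℝ => (z t - p)⁻¹ - k * t) 0 (Set.Ici 0) t := by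
    intro t ht
    have h1 : HasDerivWithinAt (fun t : ℝ => k * t) k (Set.Ici 0) t := by
      simpa using ((Complex.ofRealCLM.hasDerivAt (x := t)).const_mul k).hasDerivWithinAt
    have hp := hne t ht
    refine ((((hz t ht).sub_const p).inv hp).sub h1).congr_deriv ?_
    field_simp
    ring
  have h1 := constant_of_has_deriv_right_zero (a := 0) (b := t)
    (fun s hs => (hd s hs.1).continuousWithinAt.mono fun r hr => hr.1)
    (fun s hs => (hd s hs.1).mono fun r hr => hs.1.trans hr) t ⟨ht, le_rfl⟩
  simp only [Complex.ofReal_zero, mul_zero, sub_zero] at h1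
  rw [← h1]; ring

theorem riccati_periodic
    (hz : ∀ t, 0 ≤ t → HasDerivWithinAt z (-k * (z t - p) * (z t - q)) (Set.Ici 0) t)
    (hpq : p ≠ q) (h0 : z 0 ≠ q) {T : ℝ} (hT : 0 ≤ T)
    (hexp : Complex.exp (-k * (p - q) * T) = 1) {t : ℝ} (ht : 0 ≤ t) : z (t + T) = z t := by
  have h1 := riccati_formula hz h0 ht
  have h2 := riccati_formula hz h0 (add_nonneg ht hT)
  rw [Complex.ofReal_add, mul_add, Complex.exp_add, hexp, mul_one] at h2
  set c := (z 0 - p) / (z 0 - q) * Complex.exp (-k * (p - q) * t)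
  -- `z t` and `z (t + T)` solve the same affine equation `(1 - c) z = p - c q`; the value `c = 1`
  -- would force `p = q`.
  have hc : 1 - c ≠ 0 := by
    intro hc
    have : c = 1 := (sub_eq_zero.1 hc).symm
    rw [this] at h1
    exact hpq (by linear_combination -h1)
  apply mul_left_cancel₀ hc
  linear_combination h2 - h1

end Riccati

/-! ### Unitary groups and the interaction picture -/

section Group

variable {E : Type*} [NormedAddCommGroup E] [InnerProductSpace ℂ E]

/-- The orbit averages `∫ₐᵇ U s u` lie in the domain of the generator. -/
theorem hasDerivAt_group_integral [CompleteSpace E] {U : ℝ → E →L[ℂ] E}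
    (hadd : ∀ s t : ℝ, U (s + t) = (U s).comp (U t))
    (hcont : ∀ u : E, Continuous fun t : ℝ => U t u) (u : E) (h : ℝ) :
    HasDerivAt (fun t : ℝ => U t (∫ s in (0 : ℝ)..h, U s u)) (U h u - U 0 u) 0 := by
  -- By the group law, `U t` translates the window of integration to `[t, t + h]`.
  have key : (fun t : ℝ => U t (∫ s in (0 : ℝ)..h, U s u)) =
      fun t => (∫ s in (0 : ℝ)..(t + h), U s u) - ∫ s in (0 : ℝ)..t, U s u := by
    funext t
    rw [← ContinuousLinearMap.intervalIntegral_comp_comm _ ((hcont u).intervalIntegrable _ _),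
      intervalIntegral.integral_interval_sub_left ((hcont u).intervalIntegrable _ _)
        ((hcont u).intervalIntegrable _ _)]
    have : ∀ s, U t (U s u) = U (t + s) u := fun s => by rw [hadd]; rfl
    simp only [this]
    rw [intervalIntegral.integral_comp_add_left (fun s => U s u) t, add_zero]
  rw [key]
  have hd : ∀ t, HasDerivAt (fun t => ∫ s in (0 : ℝ)..t, U s u) (U t u) t := fun t =>
    (hcont u).integral_hasStrictDerivAt 0 t |>.hasDerivAt
  have h1 : HasDerivAt (fun t => ∫ s in (0 : ℝ)..(t + h), U s u) (U h u) 0 := by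
    have := (hd (0 + h)).comp_add_const 0 h
    simpa using this
  exact h1.sub (hd 0)

/-- A strongly continuous group whose generator is `-i` times a relation with real quadratic form
preserves the norm. -/
theorem norm_group_apply [CompleteSpace E] {U : ℝ → E →L[ℂ] E} {H : E → E → Prop}
    (hzero : U 0 = ContinuousLinearMap.id ℂ E)
    (hadd : ∀ s t : ℝ, U (s + t) = (U s).comp (U t))
    (hcont : ∀ u : E, Continuous fun t : ℝ => U t u)
    (hgen : ∀ u f : E, HasDerivAt (fun t : ℝ => U t u) (-(Complex.I • f)) 0 ↔ H u f)
    (hreal : ∀ u f, H u f → (inner ℂ u f).im = 0) (t : ℝ) (u : E) : ‖U t u‖ = ‖u‖ := by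
  have hdom : ∀ v f, H v f → ∀ t, ‖U t v‖ = ‖v‖ := by
    intro v f hvf t
    have h0 := (hgen v f).2 hvf
    have h1 : ∀ t, HasDerivAt (fun r : ℝ => U r (U t v)) (-(Complex.I • U t f)) 0 := by
      intro t
      have h2 := (((U t).restrictScalars ℝ).hasFDerivAt (x := U 0 v)).comp_hasDerivAt (0 : ℝ) h0
      have e : (fun r : ℝ => U r (U t v)) = (U t) ∘ fun r : ℝ => U r v := by
        funext r
        change ((U r).comp (U t)) v = ((U t).comp (U r)) v
        rw [← hadd, ← hadd, add_comm]
      rw [e]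
      simpa using h2
    have h2 : ∀ t, HasDerivAt (fun r : ℝ => U r v) (-(Complex.I • U t f)) t := by
      intro t
      have h3 : HasDerivAt (fun r : ℝ => U r (U t v)) (-(Complex.I • U t f)) (t - t) := by
        simpa using h1 t
      have h4 := h3.comp_sub_const t t
      have e : (fun r : ℝ => U (r - t) (U t v)) = fun r => U r v := by
        funext r
        change ((U (r - t)).comp (U t)) v = _
        rw [← hadd, sub_add_cancel]
      rwa [e] at h4
    have h3 : ∀ t, HasDerivAt (fun r : ℝ => inner ℂ (U r v) (U r v)) 0 t := by
      intro t
      -- `h1` places `U t v` in the domain with image `U t f`, so the derivative of `‖U r v‖²` at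
      -- `t`, namely `2 Im ⟨U t v, U t f⟩`, vanishes.
      have him := hreal _ _ ((hgen _ _).1 (h1 t))
      refine ((h2 t).inner ℂ (h2 t)).congr_deriv ?_
      rw [← inner_conj_symm (-(Complex.I • U t f)) (U t v), inner_neg_right, inner_smul_right]
      apply Complex.ext <;> simp only [Complex.add_re, Complex.add_im, Complex.conj_re,
        Complex.conj_im, Complex.neg_re, Complex.neg_im, Complex.mul_re, Complex.mul_im,
        Complex.I_re, Complex.I_im, Complex.zero_re, Complex.zero_im, him] <;> ring
    have h4 : inner ℂ (U t v) (U t v) = inner ℂ (U 0 v) (U 0 v) :=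
      is_const_of_deriv_eq_zero (fun t => (h3 t).differentiableAt) (fun t => (h3 t).deriv) t 0
    rw [hzero, inner_self_eq_norm_sq_to_K, inner_self_eq_norm_sq_to_K] at h4
    have h5 : ‖U t v‖ ^ 2 = ‖v‖ ^ 2 := by exact_mod_cast h4
    exact (sq_eq_sq₀ (norm_nonneg _) (norm_nonneg _)).1 h5
  -- Averages over shrinking windows lie in the domain and tend to `u`, so norm preservation passes
  -- to the limit.
  have hlim : Tendsto (fun h : ℝ => h⁻¹ • ∫ s in (0 : ℝ)..h, U s u) (𝓝[≠] 0) (𝓝 u) := by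
    have := ((hcont u).integral_hasStrictDerivAt 0 0).hasDerivAt.tendsto_slope_zero
    simpa [hzero] using this
  have h1 := (((U t).continuous.tendsto u).comp hlim).norm
  have h2 : (fun h : ℝ => ‖((U t) ∘ fun h : ℝ => h⁻¹ • ∫ s in (0 : ℝ)..h, U s u) h‖) =
      fun h : ℝ => ‖h⁻¹ • ∫ s in (0 : ℝ)..h, U s u‖ := by
    funext h
    have h3 : H (∫ s in (0 : ℝ)..h, U s u) (Complex.I • (U h u - U 0 u)) := by
      rw [← hgen]
      convert hasDerivAt_group_integral hadd hcont u h using 1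
      rw [smul_smul, Complex.I_mul_I, neg_one_smul, neg_neg]
    have e : ((U t) ∘ fun h : ℝ => h⁻¹ • ∫ s in (0 : ℝ)..h, U s u) h =
        h⁻¹ • U t (∫ s in (0 : ℝ)..h, U s u) :=
      (U t).map_smul_of_tower _ _
    rw [e, norm_smul, norm_smul, hdom _ _ h3 t]
  rw [h2] at h1
  exact tendsto_nhds_unique h1 hlim.norm

/-- A strongly continuous one-parameter group of unitary operators. -/
structure IsUnitaryGroup (U : ℝ → E →L[ℂ] E) : Prop where
  map_zero : U 0 = ContinuousLinearMap.id ℂ E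
  map_add : ∀ s t : ℝ, U (s + t) = (U s).comp (U t)
  strongly_continuous : ∀ u : E, Continuous fun t : ℝ => U t u
  norm_apply : ∀ t u, ‖U t u‖ = ‖u‖

/-- The zeroth-order part of the Schrödinger–Lohe vector field. -/
noncomputable def lohe (K ν : ℝ) (ψ χ : E) : E :=
  (ν : ℂ) • ψ + (Complex.I * ((K / 4 : ℝ) : ℂ)) • (χ - inner ℂ χ ψ • ψ)

theorem IsUnitaryGroup.inner_apply {U : ℝ → E →L[ℂ] E} (hU : IsUnitaryGroup U) (t : ℝ) (u v : E) :
    inner ℂ (U t u) (U t v) = inner ℂ u v :=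
  LinearIsometry.inner_map_map ⟨(U t).toLinearMap, hU.norm_apply t⟩ u v

theorem IsUnitaryGroup.map_lohe {U : ℝ → E →L[ℂ] E} (hU : IsUnitaryGroup U) (t K ν : ℝ) (u v : E) :
    U t (lohe K ν u v) = lohe K ν (U t u) (U t v) := by
  simp only [lohe, _root_.map_add, map_smul, map_sub, hU.inner_apply]

/-- Strong continuity and the isometry property together give joint continuity, by splitting the
variation in `τ` from that in `g`. -/
theorem IsUnitaryGroup.continuousOn_apply {U : ℝ → E →L[ℂ] E} (hU : IsUnitaryGroup U)
    {g : ℝ → E} {τ : ℝ → ℝ}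
    {S : Set ℝ} (hτ : Continuous τ) (hg : ContinuousOn g S) :
    ContinuousOn (fun s => U (τ s) (g s)) S := by
  intro s₀ hs₀
  rw [ContinuousWithinAt, tendsto_iff_norm_sub_tendsto_zero]
  have h1 : Tendsto (fun s => ‖g s - g s₀‖) (𝓝[S] s₀) (𝓝 0) :=
    tendsto_iff_norm_sub_tendsto_zero.1 (hg s₀ hs₀)
  have h2 : Tendsto (fun s => ‖U (τ s) (g s₀) - U (τ s₀) (g s₀)‖) (𝓝[S] s₀) (𝓝 0) :=
    tendsto_iff_norm_sub_tendsto_zero.1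
      ((((hU.strongly_continuous (g s₀)).comp hτ).tendsto s₀).mono_left nhdsWithin_le_nhds)
  refine squeeze_zero (fun _ => norm_nonneg _) (fun s => ?_) (by simpa using h1.add h2)
  calc ‖U (τ s) (g s) - U (τ s₀) (g s₀)‖
      = ‖U (τ s) (g s - g s₀) + (U (τ s) (g s₀) - U (τ s₀) (g s₀))‖ := by
        rw [map_sub]; congr 1; abel
    _ ≤ ‖U (τ s) (g s - g s₀)‖ + ‖U (τ s) (g s₀) - U (τ s₀) (g s₀)‖ := norm_add_le _ _
    _ = _ := by rw [hU.norm_apply]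

/-- In the interaction picture `U (-t) ψ`, Duhamel's formula is a differential equation. -/
theorem IsUnitaryGroup.hasDerivWithinAt_interaction [CompleteSpace E]
    {U : ℝ → E →L[ℂ] E} (hU : IsUnitaryGroup U) {K ν : ℝ} {u₀ : E}
    {u v : ℝ → E} (hu : ContinuousOn u (Set.Ici 0)) (hv : ContinuousOn v (Set.Ici 0))
    (hduh : ∀ t : ℝ, 0 ≤ t →
      u t = U t u₀ - Complex.I • ∫ s in (0 : ℝ)..t, U (t - s) (lohe K ν (u s) (v s)))
    {t : ℝ} (ht : 0 ≤ t) :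
    HasDerivWithinAt (fun t => U (-t) (u t))
      (-(Complex.I • lohe K ν (U (-t) (u t)) (U (-t) (v t)))) (Set.Ici 0) t := by
  have hg : ContinuousOn (fun s => lohe K ν (u s) (v s)) (Set.Ici 0) := by
    unfold lohe
    exact (hu.const_smul _).add ((hv.sub ((hv.inner hu).smul hu)).const_smul _)
  have hh : ContinuousOn (fun s => U (-s) (lohe K ν (u s) (v s))) (Set.Ici 0) :=
    hU.continuousOn_apply continuous_neg hg
  have e : ∀ t ∈ Set.Ici (0 : ℝ), U (-t) (u t) =
      u₀ - Complex.I • ∫ s in (0 : ℝ)..t, U (-s) (lohe K ν (u s) (v s)) := by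
    intro t ht
    have hinv : ∀ w, U (-t) (U t w) = w := fun w => by
      change ((U (-t)).comp (U t)) w = w
      rw [← hU.map_add, neg_add_cancel, hU.map_zero]; rfl
    -- Writing `U (t - s) = U t ∘ U (-s)` pulls `U t` out of the Duhamel integral; `U (-t)` then
    -- cancels it.
    have h2 : ∫ s in (0 : ℝ)..t, U (t - s) (lohe K ν (u s) (v s)) =
        U t (∫ s in (0 : ℝ)..t, U (-s) (lohe K ν (u s) (v s))) := by
      rw [← ContinuousLinearMap.intervalIntegral_comp_comm]
      · refine intervalIntegral.integral_congr fun s _ => ?_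
        simp only [sub_eq_add_neg, hU.map_add]; rfl
      · refine ContinuousOn.intervalIntegrable (hh.mono fun s hs => ?_)
        rw [Set.uIcc_of_le ht] at hs
        exact hs.1
    rw [hduh t ht, h2, map_sub, map_smul, hinv, hinv]
  rw [← hU.map_lohe]
  exact ((((hasDerivWithinAt_integral_Ici hh ht).const_smul Complex.I).const_sub u₀)).congr e
    (e t ht)

variable {K ν : ℝ} {φ χ : ℝ → E}

/-- The defect `1 - ‖φ‖²` solves a linear homogeneous equation and starts at zero. The partner `χ`
enters only through a continuous coefficient. -/
theorem norm_eq_one_of_lohe (hχ : ContinuousOn χ (Set.Ici 0))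
    (hφ : ∀ t, 0 ≤ t →
      HasDerivWithinAt φ (-(Complex.I • lohe K ν (φ t) (χ t))) (Set.Ici 0) t)
    (h0 : ‖φ 0‖ = 1) {t : ℝ} (ht : 0 ≤ t) : ‖φ t‖ = 1 := by
  have hφc : ContinuousOn φ (Set.Ici 0) := fun t ht => (hφ t ht).continuousWithinAt
  have h := eq_mul_exp_integral (y := fun t => 1 - inner ℂ (φ t) (φ t))
    (a := fun t => -(K / 4 : ℂ) * (inner ℂ (φ t) (χ t) + inner ℂ (χ t) (φ t)))
    (fun t ht => by
      refine (((hφ t ht).inner ℂ (hφ t ht)).const_sub 1).congr_deriv ?_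
      simp only [lohe, inner_neg_left, inner_neg_right, inner_smul_left, inner_smul_right,
        inner_add_left, inner_add_right, inner_sub_left, inner_sub_right, map_mul,
        Complex.conj_I, Complex.conj_ofReal, inner_conj_symm]
      push_cast
      linear_combination ((K / 4 : ℂ) * (inner ℂ (φ t) (χ t) + inner ℂ (χ t) (φ t)) *
        (1 - inner ℂ (φ t) (φ t))) * Complex.I_sq)
    (continuousOn_const.mul ((hφc.inner hχ).add (hχ.inner hφc))) ht
  simp only [inner_self_eq_norm_sq_to_K, h0, Complex.coe_algebraMap] at h
  have h1 : (1 : ℂ) - (‖φ t‖ : ℂ) ^ 2 = 0 := by simpa using h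
  have h2 : ‖φ t‖ ^ 2 = 1 := by
    have : ((‖φ t‖ ^ 2 : ℝ) : ℂ) = 1 := by push_cast; linear_combination -h1
    exact_mod_cast this
  exact (sq_eq_sq₀ (norm_nonneg _) zero_le_one).1 (by rw [h2, one_pow])

/-- The opposite frequencies add up, because the inner product is conjugate-linear in its first
slot; the unit norms close the equation in the correlation alone. -/
theorem hasDerivWithinAt_inner_of_lohe
    (hφ : ∀ t, 0 ≤ t →
      HasDerivWithinAt φ (-(Complex.I • lohe K ν (φ t) (χ t))) (Set.Ici 0) t)
    (hχ : ∀ t, 0 ≤ t →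
      HasDerivWithinAt χ (-(Complex.I • lohe K (-ν) (χ t) (φ t))) (Set.Ici 0) t)
    (hφ1 : ∀ t, 0 ≤ t → ‖φ t‖ = 1) (hχ1 : ∀ t, 0 ≤ t → ‖χ t‖ = 1) {t : ℝ} (ht : 0 ≤ t) :
    HasDerivWithinAt (fun t => inner ℂ (φ t) (χ t))
      (2 * Complex.I * ν * inner ℂ (φ t) (χ t) + K / 2 * (1 - inner ℂ (φ t) (χ t) ^ 2))
      (Set.Ici 0) t := by
  have h1 : inner ℂ (φ t) (φ t) = 1 := by rw [inner_self_eq_norm_sq_to_K, hφ1 t ht]; simp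
  have h2 : inner ℂ (χ t) (χ t) = 1 := by rw [inner_self_eq_norm_sq_to_K, hχ1 t ht]; simp
  refine ((hφ t ht).inner ℂ (hχ t ht)).congr_deriv ?_
  simp only [lohe, inner_neg_left, inner_neg_right, inner_smul_left, inner_smul_right,
    inner_add_left, inner_add_right, inner_sub_left, inner_sub_right, map_mul,
    Complex.conj_I, Complex.conj_ofReal, inner_conj_symm, h1, h2]
  push_cast
  linear_combination -(K / 2 : ℂ) * (1 - inner ℂ (φ t) (χ t) ^ 2) * Complex.I_sq

/-- For a pair of coupled oscillators in mild form, the masses are conserved and the correlation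
solves a Riccati equation. -/
theorem IsUnitaryGroup.norm_eq_one_and_hasDerivWithinAt [CompleteSpace E] {U : ℝ → E →L[ℂ] E}
    (hU : IsUnitaryGroup U) {K ν : ℝ} {u₀ v₀ : E} {u v : ℝ → E}
    (hu : ContinuousOn u (Set.Ici 0)) (hv : ContinuousOn v (Set.Ici 0))
    (hu₀ : ‖u₀‖ = 1) (hv₀ : ‖v₀‖ = 1)
    (hdu : ∀ t : ℝ, 0 ≤ t →
      u t = U t u₀ - Complex.I • ∫ s in (0 : ℝ)..t, U (t - s) (lohe K ν (u s) (v s)))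
    (hdv : ∀ t : ℝ, 0 ≤ t →
      v t = U t v₀ - Complex.I • ∫ s in (0 : ℝ)..t, U (t - s) (lohe K (-ν) (v s) (u s))) :
    u 0 = u₀ ∧ v 0 = v₀ ∧ (∀ t, 0 ≤ t → ‖u t‖ = 1) ∧ (∀ t, 0 ≤ t → ‖v t‖ = 1) ∧
    ∀ t, 0 ≤ t → HasDerivWithinAt (fun t => inner ℂ (u t) (v t))
      (2 * Complex.I * ν * inner ℂ (u t) (v t) + K / 2 * (1 - inner ℂ (u t) (v t) ^ 2))
      (Set.Ici 0) t := by
  have e0 : u 0 = u₀ := by simpa [hU.map_zero] using hdu 0 le_rfl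
  have e1 : v 0 = v₀ := by simpa [hU.map_zero] using hdv 0 le_rfl
  have h0 := fun t (ht : 0 ≤ t) => hU.hasDerivWithinAt_interaction hu hv hdu ht
  have h1 := fun t (ht : 0 ≤ t) => hU.hasDerivWithinAt_interaction hv hu hdv ht
  have n0 : ∀ t, 0 ≤ t → ‖U (-t) (u t)‖ = 1 := fun t ht =>
    norm_eq_one_of_lohe (fun t ht => (h1 t ht).continuousWithinAt) h0
      (by rw [hU.norm_apply, e0, hu₀]) ht
  have n1 : ∀ t, 0 ≤ t → ‖U (-t) (v t)‖ = 1 := fun t ht =>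
    norm_eq_one_of_lohe (fun t ht => (h0 t ht).continuousWithinAt) h1
      (by rw [hU.norm_apply, e1, hv₀]) ht
  refine ⟨e0, e1, fun t ht => ?_, fun t ht => ?_, fun t ht => ?_⟩
  · simpa only [hU.norm_apply] using n0 t ht
  · simpa only [hU.norm_apply] using n1 t ht
  · simpa only [hU.inner_apply] using hasDerivWithinAt_inner_of_lohe h0 h1 n0 n1 ht

end Group

/-! ### From the Schrödinger–Lohe system to its correlation -/

/-- Testing the form against `v = u` leaves only real terms, since `V` is real. -/
theorem SchrodingerOp.im_inner_eq_zero {d : ℕ} {V : EuclideanSpace ℝ (Fin d) → ℝ} {u f : L2 d}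
    (h : SchrodingerOp V u f) : (inner ℂ u f).im = 0 := by
  obtain ⟨G, hG, hform⟩ := h
  rw [← hform u G hG]
  have h1 : ∀ i, inner ℂ (G i) (G i) = ((‖G i‖ ^ 2 : ℝ) : ℂ) := fun i => by
    rw [inner_self_eq_norm_sq_to_K]; norm_cast
  have h2 : ∀ x, (V x : ℂ) * (starRingEnd ℂ (u x) * u x) = ((V x * ‖u x‖ ^ 2 : ℝ) : ℂ) :=
    fun x => by rw [Complex.conj_mul']; push_cast; rfl
  simp only [h1, h2]
  rw [integral_complex_ofReal, ← Complex.ofReal_sum]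
  have : (1 / 2 : ℂ) = ((1 / 2 : ℝ) : ℂ) := by norm_num
  rw [this, ← Complex.ofReal_mul, ← Complex.ofReal_add, Complex.ofReal_im]

theorem IsSchrodingerGroup.isUnitaryGroup {d : ℕ} {V : EuclideanSpace ℝ (Fin d) → ℝ}
    {U : ℝ → L2 d →L[ℂ] L2 d} (hU : IsSchrodingerGroup V U) : IsUnitaryGroup U where
  map_zero := hU.map_zero
  map_add := hU.map_add
  strongly_continuous := hU.strongly_continuous
  norm_apply := norm_group_apply hU.map_zero hU.map_add hU.strongly_continuous hU.generator
    (fun _ _ h => h.im_inner_eq_zero)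

/-- Along a solution the masses are conserved and the correlation solves a Riccati equation. -/
theorem IsSolution.norm_eq_one_and_hasDerivWithinAt {d : ℕ} {V : EuclideanSpace ℝ (Fin d) → ℝ}
    {K Ω : ℝ} {ψ₀ : Fin 2 → L2 d} {ψ : Fin 2 → ℝ → L2 d} (hψ : IsSolution V K Ω ψ₀ ψ)
    (hψ₀ : ∀ j, ‖ψ₀ j‖ = 1) :
    ψ 0 0 = ψ₀ 0 ∧ ψ 1 0 = ψ₀ 1 ∧ (∀ j, ∀ t, 0 ≤ t → ‖ψ j t‖ = 1) ∧
    ∀ t, 0 ≤ t → HasDerivWithinAt (fun t => inner ℂ (ψ 0 t) (ψ 1 t))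
      (2 * Complex.I * Ω * inner ℂ (ψ 0 t) (ψ 1 t) +
        K / 2 * (1 - inner ℂ (ψ 0 t) (ψ 1 t) ^ 2)) (Set.Ici 0) t := by
  obtain ⟨hc, U, hU, hd⟩ := hψ
  obtain ⟨e0, e1, n0, n1, hz⟩ := hU.isUnitaryGroup.norm_eq_one_and_hasDerivWithinAt (hc 0) (hc 1)
    (hψ₀ 0) (hψ₀ 1) (fun t ht => (hd t ht).1) (fun t ht => (hd t ht).2)
  exact ⟨e0, e1, Fin.forall_fin_two.2 ⟨n0, n1⟩, hz⟩

/-- Makes the squared distance affine in the correlation, so that rates for `z` transfer to the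
oscillators. -/
theorem norm_smul_sub_sq {E : Type*} [NormedAddCommGroup E] [InnerProductSpace ℂ E] {u v : E}
    (hu : ‖u‖ = 1) (hv : ‖v‖ = 1) {c : ℂ} (hc : ‖c‖ = 1) :
    ‖c • u - v‖ ^ 2 = 2 - 2 * (starRingEnd ℂ c * inner ℂ u v).re := by
  rw [norm_sub_sq (𝕜 := ℂ), norm_smul, hu, hv, hc, inner_smul_left]
  simp only [RCLike.re_to_complex]
  ring

theorem norm_sub_eq_sqrt {E : Type*} [NormedAddCommGroup E] [InnerProductSpace ℂ E] {u v : E}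
    (hu : ‖u‖ = 1) (hv : ‖v‖ = 1) : ‖u - v‖ = √(2 - 2 * (inner ℂ u v).re) := by
  have h := norm_smul_sub_sq hu hv (c := 1) (by simp)
  rw [one_smul, map_one, one_mul] at h
  rw [← h, Real.sqrt_sq (norm_nonneg _)]

theorem norm_half_smul_add {E : Type*} [NormedAddCommGroup E] [InnerProductSpace ℂ E] {u v : E}
    (hu : ‖u‖ = 1) (hv : ‖v‖ = 1) :
    ‖(2 : ℂ)⁻¹ • (u + v)‖ = √((1 + (inner ℂ u v).re) / 2) := by
  have h : ‖u + v‖ ^ 2 = 2 + 2 * (inner ℂ u v).re := by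
    rw [norm_add_sq (𝕜 := ℂ), hu, hv]
    simp only [RCLike.re_to_complex]
    ring
  rw [norm_smul, norm_inv, Complex.norm_two, ← Real.sqrt_sq (norm_nonneg (u + v)), h,
    ← Real.sqrt_sq (by norm_num : (0 : ℝ) ≤ 2⁻¹), ← Real.sqrt_mul (by positivity)]
  congr 1
  ring

theorem norm_orderParameter_two {d : ℕ} {ψ : Fin 2 → ℝ → L2 d} {t : ℝ}
    (h : ∀ j, ‖ψ j t‖ = 1) :
    ‖orderParameter ψ t‖ = √((1 + (inner ℂ (ψ 0 t) (ψ 1 t)).re) / 2) := by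
  rw [← norm_half_smul_add (h 0) (h 1), orderParameter, Fin.sum_univ_two]
  norm_num

/-! ### The three regimes of `Λ` -/

section TwoOscillators

variable {d : ℕ} {K Ω Λ : ℝ} {ψ : Fin 2 → ℝ → L2 d}

theorem riccati_factor {p q z : ℂ} (hΩ : 2 * Ω = K * Λ) (hadd : p + q = 2 * Complex.I * Λ)
    (hmul : p * q = -1) :
    2 * Complex.I * Ω * z + K / 2 * (1 - z ^ 2) = -(K / 2 : ℂ) * (z - p) * (z - q) := by
  have hΩ' : 2 * (Ω : ℂ) = K * Λ := by exact_mod_cast hΩ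
  linear_combination Complex.I * z * hΩ' - (K / 2 : ℂ) * z * hadd + (K / 2 : ℂ) * hmul

theorem sqrt_roots (h : 0 ≤ 1 - Λ ^ 2) :
    ((√(1 - Λ ^ 2) : ℂ) + Complex.I * Λ) * (-(√(1 - Λ ^ 2) : ℂ) + Complex.I * Λ) = -1 := by
  have hs : (√(1 - Λ ^ 2) : ℂ) ^ 2 = 1 - (Λ : ℂ) ^ 2 := by exact_mod_cast Real.sq_sqrt h
  linear_combination -hs + (Λ : ℂ) ^ 2 * Complex.I_sq

/-- Exponential convergence of the correlation to the stable equilibrium. -/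
theorem riccati_sub_isBigO {z : ℝ → ℂ} (hK : 0 < K) (hΩ : 2 * Ω = K * Λ) (hs : 0 < 1 - Λ ^ 2)
    (h0 : z 0 ≠ -(√(1 - Λ ^ 2) : ℂ) + Complex.I * Λ) (hb : ∀ t, 0 ≤ t → ‖z t‖ ≤ 1)
    (hz : ∀ t, 0 ≤ t → HasDerivWithinAt z
      (2 * Complex.I * Ω * z t + K / 2 * (1 - z t ^ 2)) (Set.Ici 0) t) :
    (fun t => z t - (√(1 - Λ ^ 2) + Complex.I * Λ)) =O[atTop]
      fun t : ℝ => Real.exp (-(√(K ^ 2 - 4 * Ω ^ 2) * t)) := by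
  set p : ℂ := √(1 - Λ ^ 2) + Complex.I * Λ with hp
  set q : ℂ := -(√(1 - Λ ^ 2) : ℂ) + Complex.I * Λ with hq
  have hr : √(K ^ 2 - 4 * Ω ^ 2) = K * √(1 - Λ ^ 2) := by
    rw [show K ^ 2 - 4 * Ω ^ 2 = K ^ 2 * (1 - Λ ^ 2) by
      linear_combination -(2 * Ω + K * Λ) * hΩ, Real.sqrt_mul (sq_nonneg K),
      Real.sqrt_sq hK.le]
  have hz' : ∀ t, 0 ≤ t →
      HasDerivWithinAt z (-(K / 2 : ℂ) * (z t - p) * (z t - q)) (Set.Ici 0) t := fun t ht =>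
    (hz t ht).congr_deriv (riccati_factor hΩ (by rw [hp, hq]; ring) (sqrt_roots hs.le))
  refine IsBigO.of_bound (‖(z 0 - p) / (z 0 - q)‖ * (1 + ‖q‖)) ?_
  filter_upwards [eventually_ge_atTop 0] with t ht
  -- Here `p - q = 2√(1 - Λ²)`, which produces the rate `K√(1 - Λ²) = √(K² - 4Ω²)`.
  have he : -(K / 2 : ℂ) * (p - q) * t = ((-(√(K ^ 2 - 4 * Ω ^ 2) * t) : ℝ) : ℂ) := by
    rw [hr, hp, hq]; push_cast; ring
  rw [riccati_formula hz' h0 ht, he, norm_mul, norm_mul, ← Complex.ofReal_exp, Complex.norm_real,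
    mul_right_comm]
  gcongr
  exact (norm_sub_le _ _).trans (by linarith [hb t ht])

theorem norm_correlation_le (hn : ∀ j, ∀ t, 0 ≤ t → ‖ψ j t‖ = 1) {t : ℝ} (ht : 0 ≤ t) :
    ‖(inner ℂ (ψ 0 t) (ψ 1 t) : ℂ)‖ ≤ 1 := by
  simpa [hn _ t ht] using norm_inner_le_norm (𝕜 := ℂ) (ψ 0 t) (ψ 1 t)

theorem exp_I_mul_arcsin (h : Λ ∈ Set.Icc (-1 : ℝ) 1) :
    Complex.exp (Complex.I * (Real.arcsin Λ : ℂ)) = √(1 - Λ ^ 2) + Complex.I * Λ := by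
  rw [mul_comm, Complex.exp_mul_I, ← Complex.ofReal_cos, ← Complex.ofReal_sin,
    Real.cos_arcsin, Real.sin_arcsin h.1 h.2]
  ring

theorem tendsto_norm_sub (hn : ∀ j, ∀ t, 0 ≤ t → ‖ψ j t‖ = 1) {w : ℂ}
    (hw : Tendsto (fun t => (inner ℂ (ψ 0 t) (ψ 1 t) : ℂ)) atTop (𝓝 w)) :
    Tendsto (fun t => ‖ψ 0 t - ψ 1 t‖) atTop (𝓝 (√(2 - 2 * w.re))) := by
  have h1 : Tendsto (fun t => √(2 - 2 * (inner ℂ (ψ 0 t) (ψ 1 t) : ℂ).re)) atTop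
      (𝓝 (√(2 - 2 * w.re))) :=
    ((((Complex.continuous_re.tendsto w).comp hw).const_mul 2).const_sub 2).sqrt
  refine h1.congr' ?_
  filter_upwards [eventually_ge_atTop 0] with t ht
  exact (norm_sub_eq_sqrt (hn 0 t ht) (hn 1 t ht)).symm

theorem tendsto_norm_orderParameter (hn : ∀ j, ∀ t, 0 ≤ t → ‖ψ j t‖ = 1) {w : ℂ}
    (hw : Tendsto (fun t => (inner ℂ (ψ 0 t) (ψ 1 t) : ℂ)) atTop (𝓝 w)) :
    Tendsto (fun t => ‖orderParameter ψ t‖) atTop (𝓝 (√((1 + w.re) / 2))) := by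
  have h1 : Tendsto (fun t => √((1 + (inner ℂ (ψ 0 t) (ψ 1 t) : ℂ).re) / 2)) atTop
      (𝓝 (√((1 + w.re) / 2))) :=
    ((((Complex.continuous_re.tendsto w).comp hw).const_add 1).div_const 2).sqrt
  refine h1.congr' ?_
  filter_upwards [eventually_ge_atTop 0] with t ht
  exact (norm_orderParameter_two fun j => hn j t ht).symm

theorem tendsto_norm_sub_all {c : ℝ}
    (h : Tendsto (fun t => ‖ψ 0 t - ψ 1 t‖) atTop (𝓝 c)) (j k : Fin 2) :
    Tendsto (fun t => ‖ψ j t - ψ k t‖) atTop (𝓝 (if j = k then 0 else c)) := by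
  have h' : Tendsto (fun t => ‖ψ 1 t - ψ 0 t‖) atTop (𝓝 c) := by simpa only [norm_sub_rev] using h
  fin_cases j <;> fin_cases k <;> simp [h, h']

theorem sync_subcritical (hK : 0 < K) (hΩ : 2 * Ω = K * Λ) (hΛ0 : 0 ≤ Λ) (hΛ : Λ < 1)
    (h0 : inner ℂ (ψ 0 0) (ψ 1 0) ≠ -(√(1 - Λ ^ 2) : ℂ) + Complex.I * Λ)
    (hn : ∀ j, ∀ t, 0 ≤ t → ‖ψ j t‖ = 1)
    (hz : ∀ t, 0 ≤ t → HasDerivWithinAt (fun t => inner ℂ (ψ 0 t) (ψ 1 t))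
      (2 * Complex.I * Ω * inner ℂ (ψ 0 t) (ψ 1 t) +
        K / 2 * (1 - inner ℂ (ψ 0 t) (ψ 1 t) ^ 2)) (Set.Ici 0) t) :
    (Λ = 0 → CompletePhaseSync ψ) ∧ (0 < Λ → CompleteFrequencySync ψ) ∧
    (fun t : ℝ => ‖Complex.exp (Complex.I * (Real.arcsin Λ : ℂ)) • ψ 0 t - ψ 1 t‖ ^ 2)
      =O[atTop] (fun t : ℝ => Real.exp (-(√(K ^ 2 - 4 * Ω ^ 2) * t))) ∧
    Tendsto (fun t : ℝ => ‖ψ 0 t - ψ 1 t‖) atTop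
      (𝓝 ‖(1 : ℂ) - Complex.exp (Complex.I * (Real.arcsin Λ : ℂ))‖) := by
  have hs : 0 < 1 - Λ ^ 2 := by nlinarith
  have hO := riccati_sub_isBigO hK hΩ hs h0 (fun t => norm_correlation_le hn) hz
  have hexp := exp_I_mul_arcsin (Λ := Λ) ⟨by linarith, hΛ.le⟩
  have hnexp : ‖Complex.exp (Complex.I * (Real.arcsin Λ : ℂ))‖ = 1 := by
    rw [mul_comm, Complex.norm_exp_ofReal_mul_I]
  rw [hexp] at hnexp ⊢
  set p : ℂ := √(1 - Λ ^ 2) + Complex.I * Λ with hp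
  have hpre : p.re = √(1 - Λ ^ 2) := by simp [hp]
  have hpp : starRingEnd ℂ p * p = 1 := by rw [Complex.conj_mul', hnexp]; simp
  have hrate : 0 < √(K ^ 2 - 4 * Ω ^ 2) := by
    apply Real.sqrt_pos.2
    rw [show K ^ 2 - 4 * Ω ^ 2 = K ^ 2 * (1 - Λ ^ 2) by
      linear_combination -(2 * Ω + K * Λ) * hΩ]
    positivity
  have hexp0 : Tendsto (fun t : ℝ => Real.exp (-(√(K ^ 2 - 4 * Ω ^ 2) * t))) atTop (𝓝 0) :=
    Real.tendsto_exp_neg_atTop_nhds_zero.comp (tendsto_id.const_mul_atTop hrate)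
  have hlim : Tendsto (fun t => (inner ℂ (ψ 0 t) (ψ 1 t) : ℂ)) atTop (𝓝 p) :=
    tendsto_sub_nhds_zero_iff.1 (hO.trans_tendsto hexp0)
  have hd := tendsto_norm_sub hn hlim
  have hord := tendsto_norm_orderParameter hn hlim
  rw [hpre] at hord
  refine ⟨fun h => ?_, fun h => ?_, ?_, ?_⟩
  · have e1 : √(1 - Λ ^ 2) = 1 := by simp [h]
    rw [hpre, e1, show (2 : ℝ) - 2 * 1 = 0 by norm_num, Real.sqrt_zero] at hd
    refine ⟨fun j k => by simpa using tendsto_norm_sub_all hd j k, ?_⟩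
    simpa [e1] using hord
  · have hlt : √(1 - Λ ^ 2) < 1 := by
      rw [Real.sqrt_lt' one_pos]; nlinarith
    refine ⟨fun j k => ⟨_, tendsto_norm_sub_all hd j k⟩, _, ⟨?_, ?_⟩, hord⟩
    · exact Real.sqrt_pos.2 (by positivity)
    · rw [Real.sqrt_lt' one_pos]; linarith
  · refine IsBigO.trans (IsBigO.of_bound 2 ?_) hO
    filter_upwards [eventually_ge_atTop 0] with t ht
    rw [norm_smul_sub_sq (hn 0 t ht) (hn 1 t ht) hnexp]
    -- Since `|p| = 1`, the squared distance is linear in `z - p` and inherits its rate.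
    have e : 2 - 2 * (starRingEnd ℂ p * inner ℂ (ψ 0 t) (ψ 1 t)).re =
        -2 * (starRingEnd ℂ p * (inner ℂ (ψ 0 t) (ψ 1 t) - p)).re := by
      rw [mul_sub, hpp, Complex.sub_re, Complex.one_re]; ring
    rw [e, norm_mul, norm_neg, Real.norm_ofNat]
    gcongr
    refine (Complex.abs_re_le_norm _).trans ?_
    rw [norm_mul, RCLike.norm_conj, hnexp, one_mul]
  · convert hd using 2
    rw [eq_comm, Real.sqrt_eq_iff_eq_sq ?_ (norm_nonneg _)]
    · have := norm_smul_sub_sq (E := ℂ) (u := 1) (v := p) (by simp) hnexp (c := 1) (by simp)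
      simpa using this.symm
    · have := (Complex.re_le_norm p).trans_eq hnexp
      linarith

theorem sync_critical (hK : 0 < K) (hΩ : 2 * Ω = K)
    (h0 : inner ℂ (ψ 0 0) (ψ 1 0) ≠ Complex.I)
    (hn : ∀ j, ∀ t, 0 ≤ t → ‖ψ j t‖ = 1)
    (hz : ∀ t, 0 ≤ t → HasDerivWithinAt (fun t => inner ℂ (ψ 0 t) (ψ 1 t))
      (2 * Complex.I * Ω * inner ℂ (ψ 0 t) (ψ 1 t) +
        K / 2 * (1 - inner ℂ (ψ 0 t) (ψ 1 t) ^ 2)) (Set.Ici 0) t) :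
    (fun t : ℝ => ‖Complex.I • ψ 0 t - ψ 1 t‖) =O[atTop] (fun t : ℝ => t⁻¹) ∧
    Tendsto (fun t : ℝ => ‖ψ 0 t - ψ 1 t‖) atTop (𝓝 (√2)) := by
  have hz' := fun t (ht : 0 ≤ t) => (hz t ht).congr_deriv
    (riccati_factor (Λ := 1) (p := Complex.I) (q := Complex.I) (by rw [hΩ, mul_one])
      (by push_cast; ring) Complex.I_mul_I)
  have hinv := fun t (ht : 0 ≤ t) => riccati_double_formula hz' h0 ht
  set w : ℂ := (inner ℂ (ψ 0 0) (ψ 1 0) - Complex.I)⁻¹ with hw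
  have hA : ∀ t, 0 ≤ t → inner ℂ (ψ 0 t) (ψ 1 t) - Complex.I = (w + (K / 2 : ℂ) * t)⁻¹ :=
    fun t ht => by rw [← hinv t ht, inv_inv]
  -- For `t ≥ 4‖w‖/K`, the constant `w` costs at most half of `K t / 2`.
  have hlow : ∀ᶠ t : ℝ in atTop, K / 4 * t ≤ ‖w + (K / 2 : ℂ) * t‖ := by
    filter_upwards [eventually_ge_atTop 0, eventually_ge_atTop (4 * ‖w‖ / K)] with t ht htw
    have h1 := norm_sub_norm_le ((K / 2 : ℂ) * t) (-w)
    have h2 : ‖(K / 2 : ℂ) * t‖ = K / 2 * t := by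
      rw [norm_mul, norm_div, Complex.norm_real, Complex.norm_real, Complex.norm_two,
        Real.norm_of_nonneg ht, Real.norm_of_nonneg hK.le]
    rw [h2, norm_neg, sub_neg_eq_add, add_comm _ w] at h1
    rw [div_le_iff₀ hK] at htw
    linarith
  have hAinv : (fun t => (inner ℂ (ψ 0 t) (ψ 1 t) : ℂ) - Complex.I) =O[atTop]
      fun t : ℝ => t⁻¹ := by
    refine IsBigO.of_bound (4 / K) ?_
    filter_upwards [eventually_gt_atTop 0, hlow] with t ht hl
    rw [hA t ht.le, norm_inv, Real.norm_of_nonneg (inv_nonneg.2 ht.le)]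
    refine (inv_anti₀ (by positivity) hl).trans_eq ?_
    field_simp
  have hlim : Tendsto (fun t => (inner ℂ (ψ 0 t) (ψ 1 t) : ℂ)) atTop (𝓝 Complex.I) :=
    tendsto_sub_nhds_zero_iff.1 (hAinv.trans_tendsto tendsto_inv_atTop_zero)
  refine ⟨?_, by simpa using tendsto_norm_sub hn hlim⟩
  -- The bound `z - i = O(t⁻¹)` alone would give only `t^(-1/2)` for the distance. The square is in
  -- fact `O(t⁻²)`: it sees only the imaginary part of `(w + K t / 2)⁻¹`, whose numerator `-Im w`
  -- does not grow, as `K t / 2` is real.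
  refine IsBigO.of_pow (n := 2) two_ne_zero ?_
  refine IsBigO.of_bound (2 * ‖w‖ * (16 / K ^ 2)) ?_
  filter_upwards [eventually_gt_atTop 0, hlow] with t ht hl
  simp only [Pi.pow_apply]
  rw [norm_smul_sub_sq (hn 0 t ht.le) (hn 1 t ht.le) Complex.norm_I]
  have e : 2 - 2 * (starRingEnd ℂ Complex.I * inner ℂ (ψ 0 t) (ψ 1 t)).re =
      2 * w.im / ‖w + (K / 2 : ℂ) * t‖ ^ 2 := by
    have h1 : (inner ℂ (ψ 0 t) (ψ 1 t) : ℂ) = Complex.I + (w + (K / 2 : ℂ) * t)⁻¹ := by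
      rw [← hA t ht.le]; ring
    have h2 : (w + (K / 2 : ℂ) * t).im = w.im := by
      have : (K / 2 : ℂ) * t = ((K / 2 * t : ℝ) : ℂ) := by push_cast; ring
      rw [this]; simp
    rw [h1, mul_add, Complex.add_re, Complex.conj_I]
    simp only [Complex.neg_re, Complex.mul_re, Complex.I_re, Complex.I_im, Complex.neg_im,
      Complex.inv_im, h2, Complex.normSq_eq_norm_sq]
    ring
  have hKt : 0 < K / 4 * t := by positivity
  rw [e, norm_div, norm_mul, Real.norm_ofNat, norm_pow, norm_pow, norm_norm,
    Real.norm_of_nonneg (inv_nonneg.2 ht.le)]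
  calc 2 * ‖w.im‖ / ‖w + (K / 2 : ℂ) * t‖ ^ 2 ≤ 2 * ‖w‖ / (K / 4 * t) ^ 2 := by
        gcongr
        exact Complex.abs_im_le_norm w
    _ = 2 * ‖w‖ * (16 / K ^ 2) * t⁻¹ ^ 2 := by field_simp; norm_num

theorem exists_period (hK : 0 < K) (hΩ : 2 * Ω = K * Λ) (hΛ : 1 < Λ)
    (hn : ∀ j, ∀ t, 0 ≤ t → ‖ψ j t‖ = 1)
    (hz : ∀ t, 0 ≤ t → HasDerivWithinAt (fun t => inner ℂ (ψ 0 t) (ψ 1 t))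
      (2 * Complex.I * Ω * inner ℂ (ψ 0 t) (ψ 1 t) +
        K / 2 * (1 - inner ℂ (ψ 0 t) (ψ 1 t) ^ 2)) (Set.Ici 0) t) :
    ∃ T : ℝ, 0 < T ∧ ∀ j k : Fin 2, ∀ t : ℝ, 0 ≤ t →
      inner ℂ (ψ j (t + T)) (ψ k (t + T)) = inner ℂ (ψ j t) (ψ k t) := by
  set r := √(Λ ^ 2 - 1) with hr
  have hr0 : 0 < r := Real.sqrt_pos.2 (by nlinarith)
  have hr2 : (r : ℂ) ^ 2 = (Λ : ℂ) ^ 2 - 1 := by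
    exact_mod_cast Real.sq_sqrt (show 0 ≤ Λ ^ 2 - 1 by nlinarith)
  set p : ℂ := Complex.I * ((Λ - r : ℝ) : ℂ) with hp
  set q : ℂ := Complex.I * ((Λ + r : ℝ) : ℂ) with hq
  have hz' := fun t (ht : 0 ≤ t) => (hz t ht).congr_deriv
    (riccati_factor (p := p) (q := q) hΩ (by rw [hp, hq]; push_cast; ring) (by
      rw [hp, hq]; push_cast
      linear_combination -Complex.I ^ 2 * hr2 + Complex.I_sq))
  have hpq : p - q = -(2 * Complex.I * r) := by rw [hp, hq]; push_cast; ring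
  have hne : p ≠ q := by
    rw [← sub_ne_zero, hpq]
    simp [hr0.ne']
  -- The root `q` has modulus `Λ + r > 1`, out of reach of a correlation of unit vectors.
  have h0 : inner ℂ (ψ 0 0) (ψ 1 0) ≠ q := by
    intro h
    have h1 := norm_correlation_le hn (le_refl 0)
    rw [h, hq, norm_mul, Complex.norm_I, one_mul, Complex.norm_real, Real.norm_eq_abs] at h1
    linarith [le_abs_self (Λ + r)]
  -- The exponent `-(K/2)(p - q)t` equals `i K r t`, which gives the period `2π/(K r)`.
  have hT : 0 < 2 * Real.pi / (K * r) := by positivity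
  refine ⟨2 * Real.pi / (K * r), hT, ?_⟩
  have hper : ∀ t, 0 ≤ t → inner ℂ (ψ 0 (t + 2 * Real.pi / (K * r)))
      (ψ 1 (t + 2 * Real.pi / (K * r))) = inner ℂ (ψ 0 t) (ψ 1 t) := fun t ht => by
    refine riccati_periodic hz' hne h0 hT.le ?_ ht
    rw [hpq, ← Complex.exp_two_pi_mul_I]
    congr 1
    have hK' : (K : ℂ) ≠ 0 := by exact_mod_cast hK.ne'
    have hr' : (r : ℂ) ≠ 0 := by exact_mod_cast hr0.ne'
    push_cast
    field_simp
  have hself : ∀ j, ∀ t, 0 ≤ t → inner ℂ (ψ j t) (ψ j t) = (1 : ℂ) := fun j t ht => by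
    rw [inner_self_eq_norm_sq_to_K, hn j t ht]; simp
  refine Fin.forall_fin_two.2 ⟨Fin.forall_fin_two.2 ⟨fun t ht => ?_, hper⟩,
    Fin.forall_fin_two.2 ⟨fun t ht => ?_, fun t ht => ?_⟩⟩
  · rw [hself _ _ ht, hself _ _ (by positivity)]
  · rw [← inner_conj_symm, hper t ht, inner_conj_symm]
  · rw [hself _ _ ht, hself _ _ (by positivity)]

end TwoOscillators

end SchrodingerLohe

theorem theorem4p1 (d : ℕ) (V : EuclideanSpace ℝ (Fin d) → ℝ)
    (hV : SchrodingerLohe.AdmissiblePotential V)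
    (K Ω Λ : ℝ) (hK : 0 < K) (hΩ : 0 ≤ Ω) (hΛ : Λ = 2 * Ω / K)
    (ψ₀ : Fin 2 → SchrodingerLohe.L2 d) (hψ₀ : ∀ j, ‖ψ₀ j‖ = 1)
    (ψ : Fin 2 → ℝ → SchrodingerLohe.L2 d)
    (hψ : SchrodingerLohe.IsSolution V K Ω ψ₀ ψ) :
    (Λ < 1 →
      inner ℂ (ψ₀ 0) (ψ₀ 1) ≠ -(Real.sqrt (1 - Λ ^ 2) : ℂ) + Complex.I * (Λ : ℂ) →
        (Λ = 0 → SchrodingerLohe.CompletePhaseSync ψ) ∧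
        (0 < Λ → SchrodingerLohe.CompleteFrequencySync ψ) ∧
        (fun t : ℝ =>
            ‖Complex.exp (Complex.I * (Real.arcsin Λ : ℂ)) • ψ 0 t - ψ 1 t‖ ^ 2)
          =O[atTop] (fun t : ℝ => Real.exp (-(Real.sqrt (K ^ 2 - 4 * Ω ^ 2) * t))) ∧
        Tendsto (fun t : ℝ => ‖ψ 0 t - ψ 1 t‖) atTop
          (𝓝 ‖(1 : ℂ) - Complex.exp (Complex.I * (Real.arcsin Λ : ℂ))‖)) ∧
    (Λ = 1 →
      inner ℂ (ψ₀ 0) (ψ₀ 1) ≠ Complex.I →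
        (fun t : ℝ => ‖Complex.I • ψ 0 t - ψ 1 t‖) =O[atTop] (fun t : ℝ => t⁻¹) ∧
        Tendsto (fun t : ℝ => ‖ψ 0 t - ψ 1 t‖) atTop (𝓝 (Real.sqrt 2))) ∧
    (1 < Λ →
      ∃ T : ℝ, 0 < T ∧ ∀ j k : Fin 2, ∀ t : ℝ, 0 ≤ t →
        inner ℂ (ψ j (t + T)) (ψ k (t + T)) = inner ℂ (ψ j t) (ψ k t)) := by
  obtain ⟨e0, e1, hn, hz⟩ := SchrodingerLohe.IsSolution.norm_eq_one_and_hasDerivWithinAt hψ hψ₀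
  rw [← e0, ← e1]
  have hΩΛ : 2 * Ω = K * Λ := by rw [hΛ]; field_simp
  have hΛ0 : 0 ≤ Λ := by rw [hΛ]; positivity
  refine ⟨fun h1 h2 => SchrodingerLohe.sync_subcritical hK hΩΛ hΛ0 h1 h2 hn hz,
    fun h1 h2 => SchrodingerLohe.sync_critical hK (by rw [hΩΛ, h1, mul_one]) h2 hn hz,
    fun h1 => SchrodingerLohe.exists_period hK hΩΛ h1 hn hz⟩
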